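/- Let $-\infty\le a<0<b\le\infty$ and let $n\ge 0$ be an integer. Manifolds are smooth, Hausdorff, second countable and without boundary. For $i\in\mathbb N$ let $(\mathcal M_i,g_i(t))$, $t\in(a,b)$, be a Ricci flow (a family of Riemannian metrics, smooth in space-time, with $\partial_t g_i=-2\,\mathrm{Ric}(g_i)$) on an $n$-dimensional manifold $\mathcal M_i$ such that $(\mathcal M_i,g_i(t))$ is complete for every $t\in(a,b)$, and let $p_i\in\mathcal M_i$. Suppose that 1. for every $r>0$ there exists $M=M(r)<\infty$ such that for all $t_0,t\in(a,b)$ and all $i$ $$\sup_{B_{g_i(t_0)}(p_i,r)}\big|\mathrm{Rm}(g_i(t))\big|_{g_i(t)}\le M;$$ 2. $\inf_i \mathrm{inj}(\mathcal M_i,g_i(0),p_i)>0$, where $\mathrm{inj}$ denotes the injectivity radius. Let $(\mathcal M,g(t))$, $t\in(a,b)$, be a Ricci flow on a connected $n$-dimensional manifold $\mathcal M$, with $(\mathcal M,g(0))$ complete, and let $p\in\mathcal M$ be such that, after passing to a subsequence in $i$, $(\mathcal M_i,g_i(t),p_i)\to(\mathcal M,g(t),p)$ in the sense of Hamilton-Cheeger-Gromov: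 there are compact sets $\Omega_i\subset\mathcal M$ exhausting $\mathcal M$ (every compact subset of $\mathcal M$ lies in $\Omega_i$ for all large $i$) with $p\in\mathrm{int}(\Omega_i)$, and smooth maps $\phi_i:\Omega_i\to\mathcal M_i$, diffeomorphic onto their images, with $\phi_i(p)=p_i$, such that $\phi_i^*g_i(t)\to g(t)$ smoothly locally on $\mathcal M\times(a,b)$. Then $(\mathcal M,g(t))$ is complete for every $t\in(a,b)$. -/

import Mathlib

open Set Filter Topology Manifold ContDiff Bundle
open scoped ENNReal

noncomputable section

namespace RicciCompactness

/-! ### Local Riemannian geometry in an open set of Euclidean space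

`G` is the matrix-valued function `y ↦ (g_{ij}(y))` of the components of a metric near a point of
`ℝⁿ`. -/

section Local

variable {n : ℕ}

/-- The partial derivative `∂_i f (y)`. -/
def partialDeriv (i : Fin n) (f : EuclideanSpace ℝ (Fin n) → ℝ)
    (y : EuclideanSpace ℝ (Fin n)) : ℝ :=
  fderiv ℝ f y (EuclideanSpace.single i 1)

/-- The Christoffel symbols of the Levi-Civita connection,
`Γ^k_{ij} = ½ ∑_l g^{kl} (∂_i g_{jl} + ∂_j g_{il} - ∂_l g_{ij})`. -/
def christoffel
    (G : EuclideanSpace ℝ (Fin n) → Matrix (Fin n) (Fin n) ℝ)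
    (k i j : Fin n) (y : EuclideanSpace ℝ (Fin n)) : ℝ :=
  (1 / 2 : ℝ) * ∑ l, (G y)⁻¹ k l *
    (partialDeriv i (fun z => G z j l) y
      + partialDeriv j (fun z => G z i l) y
      - partialDeriv l (fun z => G z i j) y)

/-- The components `R^l_{ijk}` of the curvature tensor, `R(∂_i, ∂_j) ∂_k = ∑_l R^l_{ijk} ∂_l`,
where `R(X, Y) Z = ∇_X ∇_Y Z - ∇_Y ∇_X Z - ∇_{[X, Y]} Z`. -/
def curvature
    (G : EuclideanSpace ℝ (Fin n) → Matrix (Fin n) (Fin n) ℝ)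
    (l i j k : Fin n) (y : EuclideanSpace ℝ (Fin n)) : ℝ :=
  partialDeriv i (christoffel G l j k) y - partialDeriv j (christoffel G l i k) y
    + ∑ m, (christoffel G m j k y * christoffel G l i m y
      - christoffel G m i k y * christoffel G l j m y)

/-- The Ricci curvature `Ric_{jk} = ∑_i R^i_{ijk}`, the trace of `X ↦ R(X, ∂_j) ∂_k`. -/
def ricci
    (G : EuclideanSpace ℝ (Fin n) → Matrix (Fin n) (Fin n) ℝ)
    (j k : Fin n) (y : EuclideanSpace ℝ (Fin n)) : ℝ :=
  ∑ i, curvature G i i j k y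

/-- The components `R_{ijkl} = ∑_m g_{lm} R^m_{ijk}` of the `(0,4)` curvature tensor. -/
def curvatureLower
    (G : EuclideanSpace ℝ (Fin n) → Matrix (Fin n) (Fin n) ℝ)
    (i j k l : Fin n) (y : EuclideanSpace ℝ (Fin n)) : ℝ :=
  ∑ m, G y l m * curvature G m i j k y

/-- `|Rm|² = ∑ g^{ia} g^{jb} g^{kc} g^{ld} R_{ijkl} R_{abcd}`. -/
def curvatureNormSq
    (G : EuclideanSpace ℝ (Fin n) → Matrix (Fin n) (Fin n) ℝ)
    (y : EuclideanSpace ℝ (Fin n)) : ℝ :=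
  ∑ i, ∑ j, ∑ k, ∑ l, ∑ a, ∑ b, ∑ c, ∑ d,
    (G y)⁻¹ i a * (G y)⁻¹ j b *
    (G y)⁻¹ k c * (G y)⁻¹ l d *
    curvatureLower G i j k l y * curvatureLower G a b c d y

end Local

/-! ### Riemannian metrics on manifolds -/

section Metric

variable {n : ℕ} {M : Type*} [TopologicalSpace M] [ChartedSpace (EuclideanSpace ℝ (Fin n)) M]

/-- The components `h(∂_i, ∂_j)`, at the point `y` of the target of the chart centred at `x₀`, of a
field `h` of bilinear forms on the tangent spaces of `M`. -/
def chartMatrix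
    (h : ∀ x : M, TangentSpace (𝓡 n) x → TangentSpace (𝓡 n) x → ℝ)
    (x₀ : M) (y : EuclideanSpace ℝ (Fin n)) : Matrix (Fin n) (Fin n) ℝ :=
  Matrix.of fun i j =>
    h ((extChartAt (𝓡 n) x₀).symm y)
      (mfderiv (𝓡 n) (𝓡 n) (extChartAt (𝓡 n) x₀).symm y (EuclideanSpace.single i (1 : ℝ)))
      (mfderiv (𝓡 n) (𝓡 n) (extChartAt (𝓡 n) x₀).symm y (EuclideanSpace.single j (1 : ℝ)))

/-- The pull-back `φ^* h` of a field of bilinear forms under a map `φ`. -/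
def pullbackForm {N : Type*} [TopologicalSpace N] [ChartedSpace (EuclideanSpace ℝ (Fin n)) N]
    (φ : M → N) (h : ∀ x : N, TangentSpace (𝓡 n) x → TangentSpace (𝓡 n) x → ℝ)
    (x : M) (v w : TangentSpace (𝓡 n) x) : ℝ :=
  h (φ x) (mfderiv (𝓡 n) (𝓡 n) φ x v) (mfderiv (𝓡 n) (𝓡 n) φ x w)

variable [IsManifold (𝓡 n) ∞ M]

variable (n M) in
/-- Smooth Riemannian metrics on the `n`-dimensional manifold `M`. -/
abbrev SmoothMetric : Type _ :=
  ContMDiffRiemannianMetric (𝓡 n) ∞ (EuclideanSpace ℝ (Fin n))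
    (fun x : M => TangentSpace (𝓡 n) x)

/-- The bilinear forms `g_x` on the tangent spaces. -/
def metricForm (g : SmoothMetric n M) (x : M) (v w : TangentSpace (𝓡 n) x) : ℝ :=
  g.inner x v w

/-- The component matrix `(g_{ij})` of the metric `g` in the chart centred at `x₀`. -/
def metricMatrix (g : SmoothMetric n M) (x₀ : M) (y : EuclideanSpace ℝ (Fin n)) :
    Matrix (Fin n) (Fin n) ℝ :=
  chartMatrix (metricForm g) x₀ y

/-- The Riemannian distance of `g`, the infimum of the `g`-lengths of `C¹` curves (`∞` between
points of different components). -/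
def metricDist (g : SmoothMetric n M) (x y : M) : ℝ≥0∞ :=
  letI : RiemannianBundle (fun x : M => TangentSpace (𝓡 n) x) := ⟨g.toRiemannianMetric⟩
  riemannianEDist (𝓡 n) x y

/-- The open ball `B_g(p, r)`. -/
def metricBall (g : SmoothMetric n M) (p : M) (r : ℝ) : Set M :=
  {x | metricDist g p x < ENNReal.ofReal r}

/-- Completeness of `(M, g)`: Cauchy sequences for the Riemannian distance converge. -/
def IsCompleteMetric (g : SmoothMetric n M) : Prop :=
  ∀ u : ℕ → M,
    (∀ ε : ℝ≥0∞, 0 < ε → ∃ k₀ : ℕ, ∀ k ≥ k₀, ∀ l ≥ k₀, metricDist g (u k) (u l) < ε) →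
    ∃ x : M, Tendsto (fun k => metricDist g (u k) x) atTop (𝓝 0)

/-- The norm `|Rm(g)|_g (x)`, computed in the chart centred at `x`. -/
def curvatureNorm (g : SmoothMetric n M) (x : M) : ℝ :=
  √(curvatureNormSq (metricMatrix g x) (extChartAt (𝓡 n) x x))

/-- `γ` is a geodesic of `g` on the open set `s` of times: it is smooth there and, at each time
`t ∈ s`, the geodesic equation `c'' ^k + Γ^k_{ij} c'^i c'^j = 0` holds for the expression `c` of
`γ` in the chart centred at `γ t`. -/
def IsGeodesicOn (g : SmoothMetric n M) (γ : ℝ → M) (s : Set ℝ) : Prop :=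
  ContMDiffOn 𝓘(ℝ, ℝ) (𝓡 n) ∞ γ s ∧
  ∀ t ∈ s, ∀ k : Fin n,
    deriv (deriv fun τ => extChartAt (𝓡 n) (γ t) (γ τ) k) t
      + ∑ i, ∑ j, christoffel (metricMatrix g (γ t)) k i j (extChartAt (𝓡 n) (γ t) (γ t))
        * deriv (fun τ => extChartAt (𝓡 n) (γ t) (γ τ) i) t
        * deriv (fun τ => extChartAt (𝓡 n) (γ t) (γ τ) j) t = 0

/-- `exp_p` is defined on the ball `{v ∈ T_p M : |v|_g < r}` and is a diffeomorphism from it onto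
an open subset of `M`. The tangent space `T_p M` is, in Mathlib, the model space, identified
through the chart centred at `p`; the last two conditions say that `e = exp_p` on the ball: for
each `v` in it the curve `τ ↦ e (τ v)` is a geodesic that leaves `p` with velocity `v`. -/
def IsExpDiffeoOnBall (g : SmoothMetric n M) (p : M) (r : ℝ) : Prop :=
  ∃ e : OpenPartialHomeomorph (EuclideanSpace ℝ (Fin n)) M,
    e.source = {v : EuclideanSpace ℝ (Fin n) | g.inner p v v < r ^ 2} ∧
    ContMDiffOn (𝓡 n) (𝓡 n) ∞ e e.source ∧
    ContMDiffOn (𝓡 n) (𝓡 n) ∞ e.symm e.target ∧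
    e 0 = p ∧
    ∀ v ∈ e.source,
      IsGeodesicOn g (fun τ : ℝ => e (τ • v)) {τ : ℝ | τ • v ∈ e.source} ∧
      HasDerivAt (fun τ : ℝ => extChartAt (𝓡 n) p (e (τ • v))) v 0

/-- The injectivity radius `inj(M, g, p)`: the supremum of the radii of the balls about
`0 ∈ T_p M` on which `exp_p` is a diffeomorphism onto its image. -/
def injectivityRadius (g : SmoothMetric n M) (p : M) : ℝ≥0∞ :=
  ⨆ (r : ℝ) (_ : 0 < r ∧ IsExpDiffeoOnBall g p r), ENNReal.ofReal r

/-! ### Ricci flows and their convergence -/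

/-- The open interval `(a, b)` of real times, where `-∞ ≤ a` and `b ≤ ∞`. -/
def timeInterval (a b : EReal) : Set ℝ :=
  {t : ℝ | a < (t : EReal) ∧ (t : EReal) < b}

/-- `g(t)`, `t ∈ (a, b)`, is a Ricci flow: a family of metrics smooth in space-time with
`∂g/∂t = -2 Ric(g)`. Both conditions are expressed in the charts of `M`. The values of `g` at times
outside of `(a, b)` play no role. -/
structure IsRicciFlow (a b : EReal) (g : ℝ → SmoothMetric n M) : Prop where
  smooth : ∀ (x₀ : M) (i j : Fin n), ContDiffOn ℝ ∞
    (fun z : ℝ × EuclideanSpace ℝ (Fin n) => metricMatrix (g z.1) x₀ z.2 i j)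
    (timeInterval a b ×ˢ (extChartAt (𝓡 n) x₀).target)
  equation : ∀ t ∈ timeInterval a b, ∀ x₀ : M, ∀ y ∈ (extChartAt (𝓡 n) x₀).target, ∀ i j : Fin n,
    HasDerivAt (fun s : ℝ => metricMatrix (g s) x₀ y i j)
      (-2 * ricci (metricMatrix (g t) x₀) i j y) t

/-- Smooth local convergence `h_k(t) → g(t)` on `M × (a, b)`: in each chart of `M` the components,
as functions on space-time, converge locally uniformly together with all their space-time
derivatives. -/
def ConvergesSmoothlyLocally (a b : EReal)
    (h : ℕ → ℝ → ∀ x : M, TangentSpace (𝓡 n) x → TangentSpace (𝓡 n) x → ℝ)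
    (g : ℝ → SmoothMetric n M) : Prop :=
  ∀ (x₀ : M) (i j : Fin n) (m : ℕ), TendstoLocallyUniformlyOn
    (fun k => iteratedFDeriv ℝ m
      (fun z : ℝ × EuclideanSpace ℝ (Fin n) => chartMatrix (h k z.1) x₀ z.2 i j))
    (iteratedFDeriv ℝ m
      (fun z : ℝ × EuclideanSpace ℝ (Fin n) => metricMatrix (g z.1) x₀ z.2 i j))
    atTop (timeInterval a b ×ˢ (extChartAt (𝓡 n) x₀).target)

/-- Hamilton-Cheeger-Gromov convergence `(N_k, h_k(t), q_k) → (M, g(t), p)` on the time interval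
`(a, b)`: there are compact sets `Ω_k` with `p` in their interior that exhaust `M` (each compact
set lies in `Ω_k` for all large `k`), and smooth maps `φ_k : Ω_k → N_k`, diffeomorphic onto their
image, with `φ_k(p) = q_k` and `φ_k^* h_k(t) → g(t)` smoothly locally on `M × (a, b)`. As usual,
a diffeomorphism of a compact set onto its image is one defined on an open neighbourhood; the
forms `φ_k^* h_k(t)` eventually make sense near any given compact set, which is all that local
convergence sees. -/
def HCGConverges (a b : EReal) {N : ℕ → Type*} [∀ k, TopologicalSpace (N k)]
    [∀ k, ChartedSpace (EuclideanSpace ℝ (Fin n)) (N k)] [∀ k, IsManifold (𝓡 n) ∞ (N k)]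
    (h : ∀ k, ℝ → SmoothMetric n (N k)) (q : ∀ k, N k)
    (g : ℝ → SmoothMetric n M) (p : M) : Prop :=
  ∃ (Ω : ℕ → Set M) (φ : ∀ k, OpenPartialHomeomorph M (N k)),
    (∀ k, IsCompact (Ω k) ∧ p ∈ interior (Ω k)) ∧
    (∀ K : Set M, IsCompact K → ∀ᶠ k in atTop, K ⊆ Ω k) ∧
    (∀ k, Ω k ⊆ (φ k).source ∧ ContMDiffOn (𝓡 n) (𝓡 n) ∞ (φ k) (φ k).source ∧
      ContMDiffOn (𝓡 n) (𝓡 n) ∞ (φ k).symm (φ k).target ∧ φ k p = q k) ∧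
    ConvergesSmoothlyLocally a b (fun k t => pullbackForm (φ k) (metricForm (h k t))) g

end Metric

end RicciCompactness

end

/-! The point is that the curvature bound controls all times on balls of every time `t₀`, in
particular on balls of the time `t` at which completeness is to be shown.

On the ball `B_{g_i(t)}(p_i, r)` the curvature is bounded by `K(r)` for all times. This bounds the Ricci
curvature (`abs_ricci_apply_le`), and the Ricci flow equation then gives `g_i(0) ≤ C² g_i(t)` there,
with `C` independent of `i` (`IsRicciFlow.inner_le`). A point `x` of `B_{g(t)}(p, r)` is joined to
`p` by a curve of `g(t)`-length less than `r`. Its image is compact, so convergence of the metrics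
puts `φ_i(x)` into `B_{g_i(t)}(p_i, r)` for large `i` (`eventually_mem_metricBall`), and in the limit
`g(0) ≤ C² g(t)` on `B_{g(t)}(p, r)`.

A `g(t)`-Cauchy sequence is bounded because `M` is connected, and short curves between its members
stay in a fixed ball `B_{g(t)}(p, r)`. By the comparison of the metrics it is Cauchy for `g(0)`,
hence convergent, and convergence is a topological notion (`IsCompleteMetric.of_inner_le`). -/

noncomputable section

namespace RicciCompactness

/-! ### The Ricci curvature is bounded by the full curvature -/

section Local

variable {n : ℕ}

/-- Contraction of the four-tensor `R` with the columns of `L` in each of its slots, that is, its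
components in the frame formed by these columns. -/
def frameComponents (L : Matrix (Fin n) (Fin n) ℝ) (R : Fin n → Fin n → Fin n → Fin n → ℝ)
    (p q r s : Fin n) : ℝ :=
  ∑ i, ∑ j, ∑ k, ∑ l, L i p * L j q * L k r * L l s * R i j k l

/-- If `H = L Lᵀ`, the norm of a four-tensor with respect to `H` is the Euclidean norm of its
components in the frame `L`. -/
theorem sum_contract_eq_sum_frameComponents_sq (H L : Matrix (Fin n) (Fin n) ℝ)
    (hL : ∀ i a, H i a = ∑ p, L i p * L a p) (R : Fin n → Fin n → Fin n → Fin n → ℝ) :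
    ∑ i, ∑ j, ∑ k, ∑ l, ∑ a, ∑ b, ∑ c, ∑ d,
      H i a * H j b * H k c * H l d * R i j k l * R a b c d
      = ∑ p, ∑ q, ∑ r, ∑ s, frameComponents L R p q r s ^ 2 := by
  let F := Fin n × Fin n × Fin n × Fin n
  let W : F → F → ℝ := fun x P => L x.1 P.1 * L x.2.1 P.2.1 * L x.2.2.1 P.2.2.1 * L x.2.2.2 P.2.2.2
  let T : F → ℝ := fun x => R x.1 x.2.1 x.2.2.1 x.2.2.2
  have hW : ∀ x y : F, H x.1 y.1 * H x.2.1 y.2.1 * H x.2.2.1 y.2.2.1 * H x.2.2.2 y.2.2.2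
      = ∑ P : F, W x P * W y P := by
    intro x y
    simp only [hL, F, Fintype.sum_prod_type, W]
    have h4 : ∀ t u v w : Fin n → ℝ, (∑ p, t p) * (∑ q, u q) * (∑ r, v r) * (∑ s, w s)
        = ∑ p, ∑ q, ∑ r, ∑ s, t p * u q * v r * w s := by
      intro t u v w
      simp only [← Finset.mul_sum, ← Finset.sum_mul]
    rw [h4]
    refine Finset.sum_congr rfl fun p _ => Finset.sum_congr rfl fun q _ =>
      Finset.sum_congr rfl fun r _ => Finset.sum_congr rfl fun s _ => ?_
    ring
  calc _ = ∑ x : F, ∑ y : F,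
        H x.1 y.1 * H x.2.1 y.2.1 * H x.2.2.1 y.2.2.1 * H x.2.2.2 y.2.2.2 * T x * T y := by
        simp only [F, T, Fintype.sum_prod_type]
    _ = ∑ x : F, ∑ y : F, ∑ P : F, (W x P * T x) * (W y P * T y) := by
        refine Finset.sum_congr rfl fun x _ => Finset.sum_congr rfl fun y _ => ?_
        rw [hW, Finset.sum_mul, Finset.sum_mul]
        exact Finset.sum_congr rfl fun P _ => by ring
    _ = ∑ P : F, (∑ x : F, W x P * T x) ^ 2 := by
        simp only [sq, Finset.sum_mul_sum]
        rw [Finset.sum_comm_cycle]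
    _ = _ := by
        simp only [F, T, W, Fintype.sum_prod_type, frameComponents]

theorem ricci_eq_sum_curvatureLower (G : EuclideanSpace ℝ (Fin n) → Matrix (Fin n) (Fin n) ℝ)
    (y : EuclideanSpace ℝ (Fin n)) (hG : IsUnit (G y).det) (j k : Fin n) :
    ricci G j k y = ∑ i, ∑ l, (G y)⁻¹ i l * curvatureLower G i j k l y := by
  refine Finset.sum_congr rfl fun i _ => ?_
  have h := congrFun (congrArg (fun B : Matrix (Fin n) (Fin n) ℝ =>
    B.mulVec fun m => curvature G m i j k y) (Matrix.nonsing_inv_mul (G y) hG)) i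
  simp only [← Matrix.mulVec_mulVec, Matrix.one_mulVec] at h
  exact h.symm

open scoped MatrixOrder in
/-- A frame `L` that is orthonormal for the positive definite matrix `P`, and the coefficients `z`
of a vector `w` in it. -/
theorem exists_orthonormal_frame {P : Matrix (Fin n) (Fin n) ℝ} (hP : P.PosDef) (w : Fin n → ℝ) :
    ∃ (L : Matrix (Fin n) (Fin n) ℝ) (z : Fin n → ℝ), (∀ i a, P⁻¹ i a = ∑ p, L i p * L a p) ∧
      (∀ i, w i = ∑ q, L i q * z q) ∧ ∑ i, ∑ j, P i j * w i * w j = ∑ q, z q ^ 2 := by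
  obtain ⟨C, hC⟩ := CStarAlgebra.nonneg_iff_eq_star_mul_self.mp hP.posSemidef.nonneg
  have hdet : IsUnit P.det := hP.det_pos.ne'.isUnit
  rw [Matrix.star_eq_conjTranspose, Matrix.conjTranspose_eq_transpose_of_trivial] at hC
  have hCdet : IsUnit C.det := by
    rw [hC, Matrix.det_mul] at hdet
    exact isUnit_of_mul_isUnit_right hdet
  refine ⟨C⁻¹, C.mulVec w, fun i a => ?_, fun i => ?_, ?_⟩
  · rw [hC, Matrix.mul_inv_rev, ← Matrix.transpose_nonsing_inv, Matrix.mul_apply]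
    rfl
  · have : w = C⁻¹.mulVec (C.mulVec w) := by
      rw [Matrix.mulVec_mulVec, Matrix.nonsing_inv_mul C hCdet, Matrix.one_mulVec]
    exact congrFun this i
  · have h1 : ∑ i, ∑ j, P i j * w i * w j = w ⬝ᵥ P.mulVec w := by
      simp only [dotProduct, Matrix.mulVec, Finset.mul_sum]
      exact Finset.sum_congr rfl fun i _ => Finset.sum_congr rfl fun j _ => by ring
    rw [h1, hC, ← Matrix.mulVec_mulVec, Matrix.dotProduct_mulVec, Matrix.vecMul_transpose]
    simp [dotProduct, sq]

theorem abs_le_sqrt_sum_sq (S : Fin n → Fin n → Fin n → Fin n → ℝ) (p q r s : Fin n) :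
    |S p q r s| ≤ √(∑ p, ∑ q, ∑ r, ∑ s, S p q r s ^ 2) := by
  refine Real.abs_le_sqrt ?_
  have h := Finset.single_le_sum (s := Finset.univ)
    (f := fun x : Fin n × Fin n × Fin n × Fin n => S x.1 x.2.1 x.2.2.1 x.2.2.2 ^ 2)
    (fun _ _ => sq_nonneg _) (Finset.mem_univ (p, q, r, s))
  simpa only [Fintype.sum_prod_type] using h

theorem sum_ricci_eq_trace_frameComponents
    (G : EuclideanSpace ℝ (Fin n) → Matrix (Fin n) (Fin n) ℝ) (y : EuclideanSpace ℝ (Fin n))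
    (hdet : IsUnit (G y).det) (L : Matrix (Fin n) (Fin n) ℝ)
    (hinv : ∀ i a, (G y)⁻¹ i a = ∑ p, L i p * L a p) (w z : Fin n → ℝ)
    (hw : ∀ i, w i = ∑ q, L i q * z q) :
    ∑ j, ∑ k, ricci G j k y * w j * w k = ∑ p, ∑ q, ∑ r, z q * z r *
      frameComponents L (fun i j k l => curvatureLower G i j k l y) p q r p := by
  have h1 : ∀ j k, ricci G j k y
      = ∑ p, ∑ i, ∑ l, L i p * L l p * curvatureLower G i j k l y := by
    intro j k
    rw [ricci_eq_sum_curvatureLower G y hdet]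
    simp only [hinv, Finset.sum_mul]
    rw [Finset.sum_comm_cycle]
  have h2 : ∀ j k, ricci G j k y * w j * w k
      = ∑ p, ∑ q, ∑ r, z q * z r *
        ∑ i, ∑ l, L i p * L j q * L k r * L l p * curvatureLower G i j k l y := by
    intro j k
    rw [h1, hw j, hw k, mul_assoc, Finset.sum_mul_sum, Finset.sum_mul]
    refine Finset.sum_congr rfl fun p _ => ?_
    simp only [Finset.mul_sum, Finset.sum_mul]
    refine Finset.sum_congr rfl fun q _ => Finset.sum_congr rfl fun r _ =>
      Finset.sum_congr rfl fun i _ => Finset.sum_congr rfl fun l _ => ?_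
    ring
  have h3 : ∀ p q r, frameComponents L (fun i j k l => curvatureLower G i j k l y) p q r p
      = ∑ j, ∑ k, ∑ i, ∑ l, L i p * L j q * L k r * L l p * curvatureLower G i j k l y := by
    intro p q r
    rw [frameComponents, Finset.sum_comm]
    exact Finset.sum_congr rfl fun j _ => Finset.sum_comm
  have h4 : ∀ f : Fin n → Fin n → Fin n → Fin n → Fin n → ℝ,
      ∑ j, ∑ k, ∑ p, ∑ q, ∑ r, f j k p q r = ∑ p, ∑ q, ∑ r, ∑ j, ∑ k, f j k p q r := by
    intro f
    rw [Finset.sum_comm_cycle]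
    refine Finset.sum_congr rfl fun p _ => ?_
    rw [Finset.sum_comm_cycle]
    refine Finset.sum_congr rfl fun q _ => ?_
    rw [Finset.sum_comm_cycle]
  simp only [h2, h3]
  rw [h4]
  simp only [Finset.mul_sum]

/-- In an orthonormal frame the Ricci curvature is a trace of the curvature tensor, and each
component of the latter is at most `|Rm|`. -/
theorem abs_ricci_apply_le (G : EuclideanSpace ℝ (Fin n) → Matrix (Fin n) (Fin n) ℝ)
    (y : EuclideanSpace ℝ (Fin n)) (hG : (G y).PosDef) (w : Fin n → ℝ) :
    |∑ j, ∑ k, ricci G j k y * w j * w k|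
      ≤ n ^ 3 * √(curvatureNormSq G y) * ∑ i, ∑ j, G y i j * w i * w j := by
  obtain ⟨L, z, hinv, hw, hzz⟩ := exists_orthonormal_frame hG w
  have hnorm : curvatureNormSq G y = _ := sum_contract_eq_sum_frameComponents_sq _ L hinv _
  have hzle : ∀ q, |z q| ≤ √(∑ q, z q ^ 2) := fun q => Real.abs_le_sqrt
    (Finset.single_le_sum (f := fun q => z q ^ 2) (fun _ _ => sq_nonneg _) (Finset.mem_univ q))
  rw [sum_ricci_eq_trace_frameComponents G y hG.det_pos.ne'.isUnit L hinv w z hw, hzz, hnorm]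
  generalize frameComponents L (fun i j k l => curvatureLower G i j k l y) = S
  have hbound : ∀ p q r, |z q * z r * S p q r p|
      ≤ (∑ q, z q ^ 2) * √(∑ p, ∑ q, ∑ r, ∑ s, S p q r s ^ 2) := by
    intro p q r
    rw [abs_mul, abs_mul, ← Real.mul_self_sqrt (Finset.sum_nonneg fun q _ => sq_nonneg (z q))]
    exact mul_le_mul (mul_le_mul (hzle q) (hzle r) (abs_nonneg _) (Real.sqrt_nonneg _))
      (abs_le_sqrt_sum_sq S p q r p) (abs_nonneg _)
      (mul_nonneg (Real.sqrt_nonneg _) (Real.sqrt_nonneg _))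
  calc |∑ p, ∑ q, ∑ r, z q * z r * S p q r p|
      ≤ ∑ p : Fin n, ∑ q : Fin n, ∑ r : Fin n, |z q * z r * S p q r p| := by
        refine (Finset.abs_sum_le_sum_abs _ _).trans (Finset.sum_le_sum fun p _ => ?_)
        refine (Finset.abs_sum_le_sum_abs _ _).trans (Finset.sum_le_sum fun q _ => ?_)
        exact Finset.abs_sum_le_sum_abs _ _
    _ ≤ ∑ _p : Fin n, ∑ _q : Fin n, ∑ _r : Fin n,
          (∑ q, z q ^ 2) * √(∑ p, ∑ q, ∑ r, ∑ s, S p q r s ^ 2) :=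
        Finset.sum_le_sum fun p _ => Finset.sum_le_sum fun q _ =>
          Finset.sum_le_sum fun r _ => hbound p q r
    _ = _ := by
        simp only [Finset.sum_const, Finset.card_univ, Fintype.card_fin, nsmul_eq_mul]
        ring

end Local

/-! ### Bilinear forms in charts -/

section Charts

variable {n : ℕ} {M : Type*} [TopologicalSpace M] [ChartedSpace (EuclideanSpace ℝ (Fin n)) M]
  [IsManifold (𝓡 n) ∞ M]

/-- A form on tangent vectors in terms of its chart components. The bilinear map `B` records that
`h` is bilinear at the point in question. -/
theorem apply_symm_eq_sum_chartMatrix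
    (h : ∀ x : M, TangentSpace (𝓡 n) x → TangentSpace (𝓡 n) x → ℝ) (x₀ : M)
    {y : EuclideanSpace ℝ (Fin n)} (hy : y ∈ (extChartAt (𝓡 n) x₀).target)
    (B : TangentSpace (𝓡 n) ((extChartAt (𝓡 n) x₀).symm y) →L[ℝ]
      TangentSpace (𝓡 n) ((extChartAt (𝓡 n) x₀).symm y) →L[ℝ] ℝ)
    (hB : ∀ v w, h ((extChartAt (𝓡 n) x₀).symm y) v w = B v w)
    (v : TangentSpace (𝓡 n) ((extChartAt (𝓡 n) x₀).symm y)) (w : EuclideanSpace ℝ (Fin n))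
    (hw : w = mfderiv (𝓡 n) (𝓡 n) (extChartAt (𝓡 n) x₀) ((extChartAt (𝓡 n) x₀).symm y) v) :
    h ((extChartAt (𝓡 n) x₀).symm y) v v = ∑ i, ∑ j, chartMatrix h x₀ y i j * w i * w j := by
  have hcomp := mfderivWithin_extChartAt_symm_comp_mfderiv_extChartAt (I := 𝓡 n) hy
  rw [ModelWithCorners.range_eq_univ, mfderivWithin_univ] at hcomp
  set D := mfderiv (𝓡 n) (𝓡 n) (extChartAt (𝓡 n) x₀).symm y with hD
  have hv : v = D w := by
    rw [hw]
    exact (congrArg (fun T => T v) hcomp).symm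
  have hsum : w = ∑ i, w i • EuclideanSpace.single i (1 : ℝ) := by
    ext j
    simp [Finset.sum_apply, Pi.single_apply]
  have hDw : D w = ∑ i, w i • D (EuclideanSpace.single i (1 : ℝ)) := by
    conv_lhs => rw [hsum]
    exact (map_sum D _ _).trans (Finset.sum_congr rfl fun i _ => map_smul D _ _)
  rw [hB, hv, hDw]
  simp only [map_sum, map_smul, _root_.sum_apply, _root_.smul_apply,
    smul_eq_mul, Finset.mul_sum, chartMatrix, Matrix.of_apply, hB]
  refine Finset.sum_comm.trans <| Finset.sum_congr rfl fun i _ => Finset.sum_congr rfl fun j _ => ?_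
  ring

theorem apply_eq_sum_chartMatrix
    (h : ∀ x : M, TangentSpace (𝓡 n) x → TangentSpace (𝓡 n) x → ℝ) (x₀ : M)
    {x : M} (hx : x ∈ (extChartAt (𝓡 n) x₀).source)
    (B : TangentSpace (𝓡 n) x →L[ℝ] TangentSpace (𝓡 n) x →L[ℝ] ℝ)
    (hB : ∀ v w, h x v w = B v w)
    (v : TangentSpace (𝓡 n) x) (w : EuclideanSpace ℝ (Fin n))
    (hw : w = mfderiv (𝓡 n) (𝓡 n) (extChartAt (𝓡 n) x₀) x v) :
    h x v v = ∑ i, ∑ j, chartMatrix h x₀ (extChartAt (𝓡 n) x₀ x) i j * w i * w j := by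
  obtain ⟨y, hy, rfl⟩ : ∃ y ∈ (extChartAt (𝓡 n) x₀).target, (extChartAt (𝓡 n) x₀).symm y = x :=
    ⟨_, (extChartAt (𝓡 n) x₀).map_source hx, (extChartAt (𝓡 n) x₀).left_inv hx⟩
  rw [(extChartAt (𝓡 n) x₀).right_inv hy]
  exact apply_symm_eq_sum_chartMatrix h x₀ hy B hB v w hw

/-- At the centre of the chart a tangent vector is its own coordinate vector, since the tangent
space is identified with the model space through that chart. -/
theorem inner_eq_sum_metricMatrix (g : SmoothMetric n M) (x : M)
    (v : EuclideanSpace ℝ (Fin n)) :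
    g.inner x v v = ∑ i, ∑ j, metricMatrix g x (extChartAt (𝓡 n) x x) i j * v i * v j := by
  refine apply_eq_sum_chartMatrix (metricForm g) x (mem_extChartAt_source x) (g.inner x)
    (fun _ _ => rfl) v v ?_
  rw [mfderiv_extChartAt_self]
  rfl

theorem inner_self_nonneg (g : SmoothMetric n M) (x : M) (v : TangentSpace (𝓡 n) x) :
    0 ≤ g.inner x v v := by
  rcases eq_or_ne v 0 with rfl | hv
  · simp
  · exact (g.pos x v hv).le

theorem posDef_metricMatrix (g : SmoothMetric n M) (x : M) :
    (metricMatrix g x (extChartAt (𝓡 n) x x)).PosDef := by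
  refine Matrix.PosDef.of_dotProduct_mulVec_pos ?_ fun v hv => ?_
  · ext i j
    exact g.symm _ _ _
  · have h := g.pos x (WithLp.toLp 2 v : EuclideanSpace ℝ (Fin n))
      (fun h0 => hv ((WithLp.toLp_eq_zero 2).1 h0))
    rw [inner_eq_sum_metricMatrix] at h
    refine h.trans_eq ?_
    simp only [dotProduct, Matrix.mulVec, Finset.mul_sum, star_trivial]
    exact Finset.sum_congr rfl fun i _ => Finset.sum_congr rfl fun j _ => by ring

end Charts

/-! ### Distortion of the metrics along a Ricci flow -/

section Flow

variable {n : ℕ} {M : Type*} [TopologicalSpace M] [ChartedSpace (EuclideanSpace ℝ (Fin n)) M]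
  [IsManifold (𝓡 n) ∞ M]

theorem ordConnected_timeInterval (a b : EReal) : (timeInterval a b).OrdConnected :=
  ⟨fun _ hs _ ht _ hu => ⟨hs.1.trans_le (EReal.coe_le_coe_iff.2 hu.1),
    (EReal.coe_le_coe_iff.2 hu.2).trans_lt ht.2⟩⟩

/-- Grönwall's inequality, forwards and backwards in time. -/
theorem le_exp_mul_of_abs_deriv_le {f f' : ℝ → ℝ} {s : Set ℝ} (hs : s.OrdConnected) {c : ℝ}
    (hf : ∀ t ∈ s, HasDerivAt f (f' t) t) (hc : ∀ t ∈ s, |f' t| ≤ c * f t) {t₁ t₂ : ℝ}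
    (h₁ : t₁ ∈ s) (h₂ : t₂ ∈ s) : f t₂ ≤ Real.exp (c * |t₂ - t₁|) * f t₁ := by
  have hconv : Convex ℝ s := hs.convex
  have hexp : ∀ κ t : ℝ, HasDerivAt (fun t => Real.exp (κ * t)) (Real.exp (κ * t) * κ) t :=
    fun κ t => by simpa using ((hasDerivAt_id t).const_mul κ).exp
  have key : ∀ κ, ∀ t ∈ s, HasDerivAt (fun t => Real.exp (κ * t) * f t)
      (Real.exp (κ * t) * (κ * f t + f' t)) t := fun κ t ht =>
    ((hexp κ t).fun_mul (hf t ht)).congr_deriv (by ring)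
  rcases le_total t₁ t₂ with h | h
  · have hanti : AntitoneOn (fun t => Real.exp (-c * t) * f t) s := by
      refine antitoneOn_of_deriv_nonpos hconv
        (fun t ht => (key (-c) t ht).continuousAt.continuousWithinAt)
        (fun t ht => (key (-c) t (interior_subset ht)).differentiableAt.differentiableWithinAt)
        fun t ht => ?_
      rw [(key (-c) t (interior_subset ht)).deriv]
      refine mul_nonpos_of_nonneg_of_nonpos (Real.exp_pos _).le ?_
      linarith [(abs_le.1 (hc t (interior_subset ht))).2]
    have h3 := mul_le_mul_of_nonneg_left (hanti h₁ h₂ h) (Real.exp_pos (c * t₂)).le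
    simp only [← mul_assoc, ← Real.exp_add] at h3
    rw [show c * t₂ + -c * t₂ = 0 by ring, Real.exp_zero, one_mul,
      show c * t₂ + -c * t₁ = c * (t₂ - t₁) by ring] at h3
    rwa [abs_of_nonneg (sub_nonneg.2 h)]
  · have hmono : MonotoneOn (fun t => Real.exp (c * t) * f t) s := by
      refine monotoneOn_of_deriv_nonneg hconv
        (fun t ht => (key c t ht).continuousAt.continuousWithinAt)
        (fun t ht => (key c t (interior_subset ht)).differentiableAt.differentiableWithinAt)
        fun t ht => ?_
      rw [(key c t (interior_subset ht)).deriv]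
      refine mul_nonneg (Real.exp_pos _).le ?_
      linarith [(abs_le.1 (hc t (interior_subset ht))).1]
    have h3 := mul_le_mul_of_nonneg_left (hmono h₂ h₁ h) (Real.exp_pos (-c * t₂)).le
    simp only [← mul_assoc, ← Real.exp_add] at h3
    rw [show -c * t₂ + c * t₂ = 0 by ring, Real.exp_zero, one_mul,
      show -c * t₂ + c * t₁ = c * -(t₂ - t₁) by ring] at h3
    rwa [abs_of_nonpos (sub_nonpos.2 h)]

/-- Where the curvature is bounded for all times, the metrics of a Ricci flow are comparable. -/
theorem IsRicciFlow.inner_le {a b : EReal} {g : ℝ → SmoothMetric n M} (hg : IsRicciFlow a b g)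
    {x : M} {K : ℝ} (hK : ∀ t ∈ timeInterval a b, curvatureNorm (g t) x ≤ K) {t₁ t₂ : ℝ}
    (h₁ : t₁ ∈ timeInterval a b) (h₂ : t₂ ∈ timeInterval a b) (v : TangentSpace (𝓡 n) x) :
    (g t₂).inner x v v ≤ Real.exp (2 * (n ^ 3 * K) * |t₂ - t₁|) * (g t₁).inner x v v := by
  obtain ⟨w, hw⟩ : ∃ w : EuclideanSpace ℝ (Fin n), w = v := ⟨v, rfl⟩
  have hin : ∀ t, (g t).inner x v v
      = ∑ i, ∑ j, metricMatrix (g t) x (extChartAt (𝓡 n) x x) i j * w i * w j := by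
    intro t
    rw [hw]
    exact inner_eq_sum_metricMatrix (g t) x v
  refine le_exp_mul_of_abs_deriv_le (f := fun t => (g t).inner x v v)
    (f' := fun t => ∑ i, ∑ j,
      (-2 * ricci (metricMatrix (g t) x) i j (extChartAt (𝓡 n) x x)) * w i * w j)
    (ordConnected_timeInterval a b) (fun t ht => ?_) (fun t ht => ?_) h₁ h₂
  · simp only [hin]
    exact HasDerivAt.fun_sum fun i _ => HasDerivAt.fun_sum fun j _ =>
      ((hg.equation t ht x _ (mem_extChartAt_target x) i j).mul_const _).mul_const _
  · have h := abs_ricci_apply_le (metricMatrix (g t) x) (extChartAt (𝓡 n) x x)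
      (posDef_metricMatrix (g t) x) w
    have h2 : ∑ i, ∑ j, (-2 * ricci (metricMatrix (g t) x) i j (extChartAt (𝓡 n) x x)) * w i * w j
        = -2 * ∑ i, ∑ j, ricci (metricMatrix (g t) x) i j (extChartAt (𝓡 n) x x) * w i * w j := by
      simp only [Finset.mul_sum, mul_assoc]
    rw [← hin] at h
    have h3 : (n : ℝ) ^ 3 * curvatureNorm (g t) x * (g t).inner x v v
        ≤ n ^ 3 * K * (g t).inner x v v :=
      mul_le_mul_of_nonneg_right (mul_le_mul_of_nonneg_left (hK t ht) (by positivity))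
        (inner_self_nonneg (g t) x v)
    rw [h2, abs_mul, abs_neg, abs_two]
    have h4 := h.trans h3
    linarith

end Flow

/-! ### Lengths of curves and the Riemannian distance -/

section Distance

variable {n : ℕ} {M : Type*} [TopologicalSpace M] [ChartedSpace (EuclideanSpace ℝ (Fin n)) M]
  [IsManifold (𝓡 n) ∞ M]

/-- The velocity of a curve. -/
def velocity (γ : ℝ → M) (t : ℝ) : TangentSpace (𝓡 n) (γ t) :=
  mfderiv 𝓘(ℝ, ℝ) (𝓡 n) γ t (1 : ℝ)

/-- The `g`-length of a curve on `(a, b)`. The open interval avoids derivatives at the endpoints of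
the domain of the curve, where they may be junk. -/
def metricLength (g : SmoothMetric n M) (γ : ℝ → M) (a b : ℝ) : ℝ≥0∞ :=
  ∫⁻ t in Ioo a b, ENNReal.ofReal (√(g.inner (γ t) (velocity γ t) (velocity γ t)))

theorem isContinuousRiemannianBundle_tangentSpace (g : SmoothMetric n M) :
    letI : RiemannianBundle (fun x : M => TangentSpace (𝓡 n) x) := ⟨g.toRiemannianMetric⟩
    IsContinuousRiemannianBundle (EuclideanSpace ℝ (Fin n))
      (fun x : M => TangentSpace (𝓡 n) x) := by
  let : RiemannianBundle (fun x : M => TangentSpace (𝓡 n) x) := ⟨g.toRiemannianMetric⟩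
  exact ⟨⟨g.inner, g.contMDiff.continuous, fun _ _ _ => rfl⟩⟩

theorem metricLength_eq_pathELength (g : SmoothMetric n M) (γ : ℝ → M) (a b : ℝ) :
    letI : RiemannianBundle (fun x : M => TangentSpace (𝓡 n) x) := ⟨g.toRiemannianMetric⟩
    pathELength (𝓡 n) γ a b = metricLength g γ a b := by
  let : RiemannianBundle (fun x : M => TangentSpace (𝓡 n) x) := ⟨g.toRiemannianMetric⟩
  rw [pathELength_eq_lintegral_mfderiv_Ioo]
  refine MeasureTheory.lintegral_congr fun t => ?_
  rw [← ofReal_norm, norm_eq_sqrt_real_inner]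
  rfl

theorem exists_curve_of_metricDist_lt {g : SmoothMetric n M} {x y : M} {r : ℝ≥0∞}
    (h : metricDist g x y < r) : ∃ γ : ℝ → M, γ 0 = x ∧ γ 1 = y ∧
      ContMDiffOn 𝓘(ℝ, ℝ) (𝓡 n) 1 γ (Icc 0 1) ∧ metricLength g γ 0 1 < r := by
  let : RiemannianBundle (fun x : M => TangentSpace (𝓡 n) x) := ⟨g.toRiemannianMetric⟩
  obtain ⟨γ, h0, h1, hγ, hl⟩ := exists_lt_of_riemannianEDist_lt (I := 𝓡 n) h
  exact ⟨γ, h0, h1, hγ, (metricLength_eq_pathELength g γ 0 1) ▸ hl⟩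

theorem metricDist_le_metricLength (g : SmoothMetric n M) {γ : ℝ → M} {a b : ℝ}
    (hγ : ContMDiffOn 𝓘(ℝ, ℝ) (𝓡 n) 1 γ (Icc a b)) (hab : a ≤ b) :
    metricDist g (γ a) (γ b) ≤ metricLength g γ a b := by
  let : RiemannianBundle (fun x : M => TangentSpace (𝓡 n) x) := ⟨g.toRiemannianMetric⟩
  exact (metricLength_eq_pathELength g γ a b) ▸
    riemannianEDist_le_pathELength (I := 𝓡 n) hγ rfl rfl hab

theorem metricDist_le_metricLength_of_mem (g : SmoothMetric n M) {γ : ℝ → M} {t : ℝ}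
    (hγ : ContMDiffOn 𝓘(ℝ, ℝ) (𝓡 n) 1 γ (Icc 0 1)) (ht : t ∈ Icc (0 : ℝ) 1) :
    metricDist g (γ 0) (γ t) ≤ metricLength g γ 0 1 :=
  (metricDist_le_metricLength g (hγ.mono (Icc_subset_Icc_right ht.2)) ht.1).trans
    (MeasureTheory.lintegral_mono_set (Ioo_subset_Ioo_right ht.2))

theorem metricLength_le_mul {N : Type*} [TopologicalSpace N]
    [ChartedSpace (EuclideanSpace ℝ (Fin n)) N] [IsManifold (𝓡 n) ∞ N]
    {g : SmoothMetric n M} {h : SmoothMetric n N} {γ : ℝ → M} {η : ℝ → N} {a b c : ℝ} (hc : 0 ≤ c)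
    (hle : ∀ t ∈ Ioo a b, g.inner (γ t) (velocity γ t) (velocity γ t)
      ≤ c ^ 2 * h.inner (η t) (velocity η t) (velocity η t)) :
    metricLength g γ a b ≤ ENNReal.ofReal c * metricLength h η a b := by
  rw [metricLength, metricLength, ← MeasureTheory.lintegral_const_mul' _ _ ENNReal.ofReal_ne_top]
  refine MeasureTheory.setLIntegral_mono' measurableSet_Ioo fun t ht => ?_
  rw [← ENNReal.ofReal_mul hc]
  refine ENNReal.ofReal_le_ofReal ((Real.sqrt_le_sqrt (hle t ht)).trans_eq ?_)
  rw [Real.sqrt_mul (sq_nonneg c), Real.sqrt_sq hc]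

theorem metricDist_self (g : SmoothMetric n M) (x : M) : metricDist g x x = 0 := by
  let : RiemannianBundle (fun x : M => TangentSpace (𝓡 n) x) := ⟨g.toRiemannianMetric⟩
  exact riemannianEDist_self

theorem metricDist_comm (g : SmoothMetric n M) (x y : M) : metricDist g x y = metricDist g y x := by
  let : RiemannianBundle (fun x : M => TangentSpace (𝓡 n) x) := ⟨g.toRiemannianMetric⟩
  exact riemannianEDist_comm

theorem metricDist_triangle (g : SmoothMetric n M) (x y z : M) :
    metricDist g x z ≤ metricDist g x y + metricDist g y z := by
  let : RiemannianBundle (fun x : M => TangentSpace (𝓡 n) x) := ⟨g.toRiemannianMetric⟩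
  exact riemannianEDist_triangle

theorem eventually_metricDist_lt (g : SmoothMetric n M) (x : M) {c : ℝ≥0∞} (hc : 0 < c) :
    ∀ᶠ y in 𝓝 x, metricDist g x y < c := by
  let : RiemannianBundle (fun x : M => TangentSpace (𝓡 n) x) := ⟨g.toRiemannianMetric⟩
  have := isContinuousRiemannianBundle_tangentSpace g
  exact eventually_riemannianEDist_lt (𝓡 n) x hc

theorem tendsto_metricDist_iff [RegularSpace M] (g : SmoothMetric n M) {u : ℕ → M} {x : M} :
    Tendsto (fun k => metricDist g (u k) x) atTop (𝓝 0) ↔ Tendsto u atTop (𝓝 x) := by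
  let : RiemannianBundle (fun x : M => TangentSpace (𝓡 n) x) := ⟨g.toRiemannianMetric⟩
  have := isContinuousRiemannianBundle_tangentSpace g
  constructor
  · intro h s hs
    obtain ⟨c, hc, hcs⟩ := setOfPred_riemannianEDist_lt_subset_nhds' (𝓡 n) hs
    have hlt : ∀ᶠ k in atTop, metricDist g (u k) x < c := h.eventually_lt_const hc
    refine mem_map.2 (hlt.mono fun k hk => ?_)
    rw [metricDist_comm] at hk
    exact hcs hk
  · intro h
    refine ENNReal.tendsto_nhds_zero.2 fun c hc => ?_
    filter_upwards [h.eventually (eventually_metricDist_lt g x hc)] with k hk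
    rw [metricDist_comm]
    exact hk.le

theorem metricDist_ne_top [ConnectedSpace M] (g : SmoothMetric n M) (x y : M) :
    metricDist g x y ≠ ⊤ := by
  have hclopen : IsClopen {y | metricDist g x y < ⊤} := by
    refine ⟨isClosed_iff_frequently.2 fun z hz => ?_, isOpen_iff_mem_nhds.2 fun z hz => ?_⟩
    · obtain ⟨w, hw, hzw⟩ := (hz.and_eventually (eventually_metricDist_lt g z one_pos)).exists
      rw [metricDist_comm] at hzw
      exact (metricDist_triangle g x w z).trans_lt
        (ENNReal.add_lt_top.2 ⟨hw, hzw.trans ENNReal.one_lt_top⟩)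
    · filter_upwards [eventually_metricDist_lt g z one_pos] with w hw
      exact (metricDist_triangle g x z w).trans_lt
        (ENNReal.add_lt_top.2 ⟨hz, hw.trans ENNReal.one_lt_top⟩)
  have huniv := hclopen.eq_univ ⟨x, by simp [metricDist_self]⟩
  have hy : y ∈ {y | metricDist g x y < ⊤} := huniv ▸ mem_univ y
  exact hy.ne

/-- Completeness passes from `g₀` to `g₁` if `g₀` is bounded by a multiple of `g₁` on each
`g₁`-ball. A `g₁`-Cauchy sequence and short curves between its members stay in one such ball, so
the sequence is `g₀`-Cauchy, and both distances induce the topology of the manifold. -/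
theorem IsCompleteMetric.of_inner_le [ConnectedSpace M] [RegularSpace M] {g₀ g₁ : SmoothMetric n M}
    (h₀ : IsCompleteMetric g₀) (p : M)
    (hle : ∀ r : ℝ, 0 < r → ∃ c : ℝ, 0 < c ∧ ∀ x ∈ metricBall g₁ p r,
      ∀ v : TangentSpace (𝓡 n) x, g₀.inner x v v ≤ c ^ 2 * g₁.inner x v v) :
    IsCompleteMetric g₁ := by
  intro u hu
  obtain ⟨k₀, hk₀⟩ := hu 1 one_pos
  have hfin := metricDist_ne_top g₁ p (u k₀)
  obtain ⟨c, hc, hcle⟩ := hle ((metricDist g₁ p (u k₀)).toReal + 2) (by positivity)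
  have hc0 : ENNReal.ofReal c ≠ 0 := (ENNReal.ofReal_pos.2 hc).ne'
  have hshort : ∀ k ≥ k₀, ∀ l, ∀ ε, metricDist g₁ (u k) (u l) < ε → ε ≤ 1 →
      metricDist g₀ (u k) (u l) < ENNReal.ofReal c * ε := by
    intro k hk l ε hkl hε
    obtain ⟨γ, h0, h1, hγ, hlen⟩ := exists_curve_of_metricDist_lt hkl
    have hball : ∀ t ∈ Icc (0 : ℝ) 1,
        γ t ∈ metricBall g₁ p ((metricDist g₁ p (u k₀)).toReal + 2) := by
      intro t ht
      have h2 : metricDist g₁ (u k) (γ t) < 1 :=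
        ((h0 ▸ metricDist_le_metricLength_of_mem g₁ hγ ht).trans_lt hlen).trans_le hε
      have h3 : metricDist g₁ (u k₀) (γ t) < 2 :=
        (metricDist_triangle g₁ _ (u k) _).trans_lt
          ((ENNReal.add_lt_add (hk₀ k₀ le_rfl k hk) h2).trans_eq one_add_one_eq_two)
      change metricDist g₁ p (γ t) < _
      rw [ENNReal.ofReal_add ENNReal.toReal_nonneg zero_le_two, ENNReal.ofReal_toReal hfin,
        ENNReal.ofReal_ofNat]
      exact (metricDist_triangle g₁ _ (u k₀) _).trans_lt (ENNReal.add_lt_add_left hfin h3)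
    calc metricDist g₀ (u k) (u l) ≤ metricLength g₀ γ 0 1 := by
          rw [← h0, ← h1]
          exact metricDist_le_metricLength g₀ hγ zero_le_one
      _ ≤ ENNReal.ofReal c * metricLength g₁ γ 0 1 :=
          metricLength_le_mul hc.le fun t ht => hcle _ (hball t (Ioo_subset_Icc_self ht)) _
      _ < ENNReal.ofReal c * ε := ENNReal.mul_lt_mul_right hc0 ENNReal.ofReal_ne_top hlen
  obtain ⟨x, hx⟩ := h₀ u fun ε hε => by
    obtain ⟨k₁, hk₁⟩ := hu (min 1 (ε / ENNReal.ofReal c))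
      (lt_min one_pos (ENNReal.div_pos hε.ne' ENNReal.ofReal_ne_top))
    refine ⟨max k₀ k₁, fun k hk l hl => ?_⟩
    refine (hshort k ((le_max_left _ _).trans hk) l _
      (hk₁ k ((le_max_right _ _).trans hk) l ((le_max_right _ _).trans hl))
      (min_le_left _ _)).trans_le ?_
    refine (mul_le_mul_right (min_le_right _ _) _).trans ?_
    exact ENNReal.mul_div_le
  exact ⟨x, (tendsto_metricDist_iff g₁).2 ((tendsto_metricDist_iff g₀).1 hx)⟩

end Distance

/-! ### Smooth local convergence of metrics -/

section Convergence

variable {n : ℕ} {M : Type*} [TopologicalSpace M] [ChartedSpace (EuclideanSpace ℝ (Fin n)) M]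
  [IsManifold (𝓡 n) ∞ M]

/-- The chart coordinates of a tangent vector are bounded by its `g`-norm near the centre of the
chart. -/
theorem eventually_norm_sq_mfderiv_extChartAt_le (g : SmoothMetric n M) (x₀ : M) :
    ∃ C : ℝ, ∀ᶠ x in 𝓝 x₀, ∀ (v : TangentSpace (𝓡 n) x) (w : EuclideanSpace ℝ (Fin n)),
      w = mfderiv (𝓡 n) (𝓡 n) (extChartAt (𝓡 n) x₀) x v → ‖w‖ ^ 2 ≤ C ^ 2 * g.inner x v v := by
  let : RiemannianBundle (fun x : M => TangentSpace (𝓡 n) x) := ⟨g.toRiemannianMetric⟩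
  have := isContinuousRiemannianBundle_tangentSpace g
  obtain ⟨C, hC, h⟩ := eventually_norm_mfderiv_extChartAt_lt (𝓡 n) x₀
  refine ⟨C, h.mono fun x hx v w hw => ?_⟩
  have hv : g.inner x v v = ‖v‖ ^ 2 := (real_inner_self_eq_norm_sq v).symm ▸ rfl
  rw [hv, ← mul_pow]
  refine pow_le_pow_left₀ (norm_nonneg w) ?_ 2
  rw [hw]
  let := normedAddCommGroupTangentSpaceVectorSpace (extChartAt (𝓡 n) x₀ x)
  let := normedSpaceTangentSpaceVectorSpace (extChartAt (𝓡 n) x₀ x)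
  exact ContinuousLinearMap.le_of_opNorm_le (mfderiv (𝓡 n) (𝓡 n) (extChartAt (𝓡 n) x₀) x) hx.le v

theorem abs_sum_mul_mul_le {A : Fin n → Fin n → ℝ} {δ : ℝ} (hA : ∀ i j, |A i j| ≤ δ)
    (w : EuclideanSpace ℝ (Fin n)) : |∑ i, ∑ j, A i j * w i * w j| ≤ n ^ 2 * δ * ‖w‖ ^ 2 := by
  have hw : ∀ i, |w i| ≤ ‖w‖ := fun i => PiLp.norm_apply_le w i
  calc |∑ i, ∑ j, A i j * w i * w j| ≤ ∑ i : Fin n, ∑ j : Fin n, |A i j * w i * w j| :=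
        (Finset.abs_sum_le_sum_abs _ _).trans
          (Finset.sum_le_sum fun i _ => Finset.abs_sum_le_sum_abs _ _)
    _ ≤ ∑ _i : Fin n, ∑ _j : Fin n, δ * ‖w‖ * ‖w‖ := by
        refine Finset.sum_le_sum fun i _ => Finset.sum_le_sum fun j _ => ?_
        have hδ : 0 ≤ δ := (abs_nonneg _).trans (hA i j)
        rw [abs_mul, abs_mul]
        gcongr
        exacts [hA i j, hw i, hw j]
    _ = _ := by
        simp only [Finset.sum_const, Finset.card_univ, Fintype.card_fin, nsmul_eq_mul]
        ring

variable {a b : EReal} {h : ℕ → ℝ → ∀ x : M, TangentSpace (𝓡 n) x → TangentSpace (𝓡 n) x → ℝ}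
  {g : ℝ → SmoothMetric n M}

theorem ConvergesSmoothlyLocally.eventually_abs_chartMatrix_sub_lt
    (hconv : ConvergesSmoothlyLocally a b h g) {t : ℝ} (ht : t ∈ timeInterval a b) (x₀ : M)
    {δ : ℝ} (hδ : 0 < δ) (i j : Fin n) :
    ∀ᶠ z : ℕ × M in atTop ×ˢ 𝓝 x₀,
      |chartMatrix (h z.1 t) x₀ (extChartAt (𝓡 n) x₀ z.2) i j
        - metricMatrix (g t) x₀ (extChartAt (𝓡 n) x₀ z.2) i j| < δ := by
  obtain ⟨T, hT, hev⟩ := Metric.tendstoLocallyUniformlyOn_iff.1 (hconv x₀ i j 0) δ hδ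
    (t, extChartAt (𝓡 n) x₀ x₀) ⟨ht, mem_extChartAt_target x₀⟩
  have htend : Tendsto (fun x => (t, extChartAt (𝓡 n) x₀ x)) (𝓝 x₀)
      (𝓝[timeInterval a b ×ˢ (extChartAt (𝓡 n) x₀).target] (t, extChartAt (𝓡 n) x₀ x₀)) := by
    refine tendsto_nhdsWithin_iff.2
      ⟨continuousAt_const.prodMk (continuousAt_extChartAt x₀), ?_⟩
    filter_upwards [extChartAt_source_mem_nhds (I := 𝓡 n) x₀] with x hx
    exact ⟨ht, (extChartAt (𝓡 n) x₀).map_source hx⟩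
  filter_upwards [hev.prod_mk (htend hT)] with z hz
  have h1 := hz.1 _ hz.2
  rw [dist_comm, dist_eq_norm] at h1
  simp only [iteratedFDeriv_zero_eq_comp, Function.comp_apply, ← map_sub,
    LinearIsometryEquiv.norm_map, Real.norm_eq_abs] at h1
  exact h1

/-- On compact sets the forms `h k t` are eventually close to `g t`, relative to `g t`. -/
theorem ConvergesSmoothlyLocally.eventually_forall_mem_isCompact
    (hconv : ConvergesSmoothlyLocally a b h g)
    (hbilin : ∀ k t x, ∃ B : TangentSpace (𝓡 n) x →L[ℝ] TangentSpace (𝓡 n) x →L[ℝ] ℝ,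
      ∀ v w, h k t x v w = B v w) {t : ℝ} (ht : t ∈ timeInterval a b) {K : Set M}
    (hK : IsCompact K) {ε : ℝ} (hε : 0 < ε) :
    ∀ᶠ k in atTop, ∀ x ∈ K, ∀ v : TangentSpace (𝓡 n) x,
      |h k t x v v - (g t).inner x v v| ≤ ε * (g t).inner x v v := by
  have hloc : ∀ x₀ ∈ K, {z : ℕ × M | ∀ v : TangentSpace (𝓡 n) z.2,
      |h z.1 t z.2 v v - (g t).inner z.2 v v| ≤ ε * (g t).inner z.2 v v}
        ∈ (atTop : Filter ℕ) ×ˢ 𝓝 x₀ := by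
    intro x₀ _
    obtain ⟨C, hC⟩ := eventually_norm_sq_mfderiv_extChartAt_le (g t) x₀
    have hδ : 0 < ε / (n ^ 2 * C ^ 2 + 1) := by positivity
    have hent := eventually_all.2 fun i => eventually_all.2 fun j =>
      hconv.eventually_abs_chartMatrix_sub_lt ht x₀ hδ i j
    have hM := (hC.and (extChartAt_source_mem_nhds (I := 𝓡 n) x₀)).prod_inr (atTop : Filter ℕ)
    filter_upwards [hent, hM] with z hz hz2 v
    obtain ⟨hzC, hzs⟩ := hz2
    obtain ⟨B, hB⟩ := hbilin z.1 t z.2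
    obtain ⟨w, hw⟩ : ∃ w : EuclideanSpace ℝ (Fin n),
      w = mfderiv (𝓡 n) (𝓡 n) (extChartAt (𝓡 n) x₀) z.2 v := ⟨_, rfl⟩
    have e1 := apply_eq_sum_chartMatrix (h z.1 t) x₀ hzs B hB v w hw
    have e2 : (g t).inner z.2 v v = _ := apply_eq_sum_chartMatrix (metricForm (g t)) x₀ hzs
      ((g t).inner z.2) (fun _ _ => rfl) v w hw
    have e3 : h z.1 t z.2 v v - (g t).inner z.2 v v
        = ∑ i, ∑ j, (chartMatrix (h z.1 t) x₀ (extChartAt (𝓡 n) x₀ z.2) i j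
        - metricMatrix (g t) x₀ (extChartAt (𝓡 n) x₀ z.2) i j) * w i * w j := by
      rw [e1, e2]
      simp only [sub_mul, Finset.sum_sub_distrib]
      rfl
    rw [e3]
    refine (abs_sum_mul_mul_le (fun i j => (hz i j).le) w).trans ?_
    have hg0 := inner_self_nonneg (g t) z.2 v
    calc (n : ℝ) ^ 2 * (ε / (n ^ 2 * C ^ 2 + 1)) * ‖w‖ ^ 2
        ≤ n ^ 2 * (ε / (n ^ 2 * C ^ 2 + 1)) * (C ^ 2 * (g t).inner z.2 v v) := by
          gcongr
          exact hzC v w hw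
      _ = (n ^ 2 * C ^ 2 / (n ^ 2 * C ^ 2 + 1)) * (ε * (g t).inner z.2 v v) := by ring
      _ ≤ 1 * (ε * (g t).inner z.2 v v) := by
          gcongr
          rw [div_le_one (by positivity)]
          linarith
      _ = _ := one_mul _
  have hmem : {z : ℕ × M | ∀ v : TangentSpace (𝓡 n) z.2,
      |h z.1 t z.2 v v - (g t).inner z.2 v v| ≤ ε * (g t).inner z.2 v v}
        ∈ (atTop : Filter ℕ) ×ˢ 𝓝ˢ K := hK.mem_prod_nhdsSet_of_forall hloc
  exact (Filter.Eventually.curry hmem).mono fun k hk x hx => hk.self_of_nhdsSet x hx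

theorem ConvergesSmoothlyLocally.tendsto_apply
    (hconv : ConvergesSmoothlyLocally a b h g)
    (hbilin : ∀ k t x, ∃ B : TangentSpace (𝓡 n) x →L[ℝ] TangentSpace (𝓡 n) x →L[ℝ] ℝ,
      ∀ v w, h k t x v w = B v w) {t : ℝ} (ht : t ∈ timeInterval a b) (x : M)
    (v : TangentSpace (𝓡 n) x) :
    Tendsto (fun k => h k t x v v) atTop (𝓝 ((g t).inner x v v)) := by
  refine Metric.tendsto_nhds.2 fun ε hε => ?_
  have hg0 := inner_self_nonneg (g t) x v
  filter_upwards [hconv.eventually_forall_mem_isCompact hbilin ht (isCompact_singleton (x := x))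
    (ε := ε / ((g t).inner x v v + 1)) (by positivity)] with k hk
  refine (hk x rfl v).trans_lt ?_
  rw [div_mul_eq_mul_div, div_lt_iff₀ (by positivity)]
  linarith

end Convergence

/-! ### Metrics of the limit flow at different times -/

section Limit

variable {n : ℕ} {M : Type*} [TopologicalSpace M] [ChartedSpace (EuclideanSpace ℝ (Fin n)) M]
  [IsManifold (𝓡 n) ∞ M]

theorem exists_pullbackForm_eq {M : Type*} [TopologicalSpace M]
    [ChartedSpace (EuclideanSpace ℝ (Fin n)) M] {N : Type*} [TopologicalSpace N]
    [ChartedSpace (EuclideanSpace ℝ (Fin n)) N] [IsManifold (𝓡 n) ∞ N] (φ : M → N)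
    (h : SmoothMetric n N) (x : M) :
    ∃ B : TangentSpace (𝓡 n) x →L[ℝ] TangentSpace (𝓡 n) x →L[ℝ] ℝ,
      ∀ v w, pullbackForm φ (metricForm h) x v w = B v w := by
  let A : EuclideanSpace ℝ (Fin n) →L[ℝ] EuclideanSpace ℝ (Fin n) →L[ℝ] ℝ := h.inner (φ x)
  let D : EuclideanSpace ℝ (Fin n) →L[ℝ] EuclideanSpace ℝ (Fin n) := mfderiv (𝓡 n) (𝓡 n) φ x
  exact ⟨A.bilinearComp D D, fun _ _ => rfl⟩

/-- A curve of length less than `r` stays shorter than `r` under maps for which the pulled back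
metrics converge. -/
theorem eventually_mem_metricBall {a b : EReal} {N : ℕ → Type*} [∀ k, TopologicalSpace (N k)]
    [∀ k, ChartedSpace (EuclideanSpace ℝ (Fin n)) (N k)] [∀ k, IsManifold (𝓡 n) ∞ (N k)]
    {h : ∀ k, ℝ → SmoothMetric n (N k)} {g : ℝ → SmoothMetric n M}
    {φ : ∀ k, OpenPartialHomeomorph M (N k)}
    (hsource : ∀ K : Set M, IsCompact K → ∀ᶠ k in atTop, K ⊆ (φ k).source)
    (hφ : ∀ k, ContMDiffOn (𝓡 n) (𝓡 n) ∞ (φ k) (φ k).source)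
    (hconv : ConvergesSmoothlyLocally a b (fun k t => pullbackForm (φ k) (metricForm (h k t))) g)
    {t : ℝ} (ht : t ∈ timeInterval a b) {p x : M} {r : ℝ} (hx : x ∈ metricBall (g t) p r) :
    ∀ᶠ k in atTop, φ k x ∈ metricBall (h k t) (φ k p) r := by
  obtain ⟨γ, h0, h1, hγ, hlen⟩ := exists_curve_of_metricDist_lt hx
  -- room for a factor `c > 1` in the length of the image curves
  obtain ⟨c, hcr, hc⟩ : ∃ c : ℝ,
      ENNReal.ofReal c * metricLength (g t) γ 0 1 < ENNReal.ofReal r ∧ 1 < c := by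
    have htend : Tendsto (fun c : ℝ => ENNReal.ofReal c * metricLength (g t) γ 0 1) (𝓝[>] 1)
        (𝓝 (ENNReal.ofReal 1 * metricLength (g t) γ 0 1)) :=
      ENNReal.Tendsto.mul_const
        ((ENNReal.continuous_ofReal.tendsto 1).mono_left nhdsWithin_le_nhds) (Or.inr hlen.ne_top)
    rw [ENNReal.ofReal_one, one_mul] at htend
    exact ((htend.eventually_lt_const hlen).and self_mem_nhdsWithin).exists
  have hcpt : IsCompact (γ '' Icc 0 1) := isCompact_Icc.image_of_continuousOn hγ.continuousOn
  have hε : 0 < c ^ 2 - 1 := by nlinarith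
  filter_upwards [hsource _ hcpt, hconv.eventually_forall_mem_isCompact
    (fun k t x => exists_pullbackForm_eq (φ k) (h k t) x) ht hcpt hε] with k hk hk2
  have hcomp : ContMDiffOn 𝓘(ℝ, ℝ) (𝓡 n) 1 (φ k ∘ γ) (Icc 0 1) :=
    ((hφ k).of_le (by exact_mod_cast le_top)).comp hγ (image_subset_iff.1 hk)
  have hvel : ∀ s ∈ Ioo (0 : ℝ) 1, velocity (φ k ∘ γ) s
      = mfderiv (𝓡 n) (𝓡 n) (φ k) (γ s) (velocity γ s) := by
    intro s hs
    have hs' := Ioo_subset_Icc_self hs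
    have d1 : MDifferentiableAt (𝓡 n) (𝓡 n) (φ k) (γ s) :=
      ((hφ k).contMDiffAt ((φ k).open_source.mem_nhds (hk (mem_image_of_mem γ hs')))
        ).mdifferentiableAt (by simp)
    have d2 : MDifferentiableAt 𝓘(ℝ, ℝ) (𝓡 n) γ s :=
      (hγ.contMDiffAt (Icc_mem_nhds hs.1 hs.2)).mdifferentiableAt one_ne_zero
    have hc := mfderiv_comp s d1 d2
    exact congrArg (fun T => T (1 : ℝ)) hc
  have hle : metricLength (h k t) (φ k ∘ γ) 0 1
      ≤ ENNReal.ofReal c * metricLength (g t) γ 0 1 := by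
    refine metricLength_le_mul (by linarith) fun s hs => ?_
    have h2 := (abs_le.1 (hk2 (γ s) (mem_image_of_mem γ (Ioo_subset_Icc_self hs))
      (velocity γ s))).2
    have h3 : (h k t).inner ((φ k ∘ γ) s) (velocity (φ k ∘ γ) s) (velocity (φ k ∘ γ) s)
        = pullbackForm (φ k) (metricForm (h k t)) (γ s) (velocity γ s) (velocity γ s) := by
      rw [hvel s hs]
      rfl
    rw [h3]
    linarith
  have hd := metricDist_le_metricLength (h k t) hcomp zero_le_one
  simp only [Function.comp_apply, h0, h1] at hd
  exact (hd.trans hle).trans_lt hcr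

end Limit

end RicciCompactness

end

theorem theorem1p7 (n : ℕ) (a b : EReal) (ha : a < 0) (hb : 0 < b)
    -- the pointed complete Ricci flows
    (N : ℕ → Type*) [∀ i, TopologicalSpace (N i)]
    [∀ i, ChartedSpace (EuclideanSpace ℝ (Fin n)) (N i)] [∀ i, IsManifold (𝓡 n) ∞ (N i)]
    [∀ i, T2Space (N i)] [∀ i, SecondCountableTopology (N i)]
    (h : ∀ i, ℝ → RicciCompactness.SmoothMetric n (N i))
    (h_flow : ∀ i, RicciCompactness.IsRicciFlow a b (h i))
    (h_complete : ∀ i, ∀ t ∈ RicciCompactness.timeInterval a b,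
      RicciCompactness.IsCompleteMetric (h i t))
    (q : ∀ i, N i)
    -- the curvature bound on all balls about the base points, and the injectivity radius bound
    (h_curv : ∀ r : ℝ, 0 < r → ∃ K : ℝ, ∀ t₀ ∈ RicciCompactness.timeInterval a b,
      ∀ t ∈ RicciCompactness.timeInterval a b, ∀ i,
      ∀ x ∈ RicciCompactness.metricBall (h i t₀) (q i) r,
        RicciCompactness.curvatureNorm (h i t) x ≤ K)
    (h_inj : 0 < ⨅ i, RicciCompactness.injectivityRadius (h i 0) (q i))
    -- a limit flow, complete at time 0, of a subsequence
    (M : Type*) [TopologicalSpace M] [ChartedSpace (EuclideanSpace ℝ (Fin n)) M]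
    [IsManifold (𝓡 n) ∞ M] [T2Space M] [SecondCountableTopology M] [ConnectedSpace M]
    (g : ℝ → RicciCompactness.SmoothMetric n M) (p : M)
    (g_flow : RicciCompactness.IsRicciFlow a b g)
    (g_complete : RicciCompactness.IsCompleteMetric (g 0))
    (σ : ℕ → ℕ) (hσ : StrictMono σ)
    (h_lim : RicciCompactness.HCGConverges a b (fun k => h (σ k)) (fun k => q (σ k)) g p) :
    ∀ t ∈ RicciCompactness.timeInterval a b, RicciCompactness.IsCompleteMetric (g t) := by
  obtain ⟨Ω, φ, -, hΩ, hφ, hconv⟩ := h_lim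
  have : LocallyCompactSpace M := ChartedSpace.locallyCompactSpace (EuclideanSpace ℝ (Fin n)) M
  have h0 : (0 : ℝ) ∈ RicciCompactness.timeInterval a b := ⟨ha, hb⟩
  intro t ht
  refine g_complete.of_inner_le p fun r hr => ?_
  obtain ⟨K, hK⟩ := h_curv r hr
  refine ⟨√(Real.exp (2 * (n ^ 3 * K) * |0 - t|)), Real.sqrt_pos.2 (Real.exp_pos _),
    fun x hx v => ?_⟩
  rw [Real.sq_sqrt (Real.exp_pos _).le]
  have hbilin := fun (k : ℕ) (t : ℝ) (x : M) =>
    RicciCompactness.exists_pullbackForm_eq (φ k) (h (σ k) t) x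
  have hlim : ∀ s ∈ RicciCompactness.timeInterval a b, Tendsto
      (fun k => RicciCompactness.pullbackForm (φ k) (RicciCompactness.metricForm (h (σ k) s)) x v v)
      atTop (𝓝 ((g s).inner x v v)) := fun s hs => hconv.tendsto_apply hbilin hs x v
  refine le_of_tendsto_of_tendsto (hlim 0 h0) ((hlim t ht).const_mul _) ?_
  have hsource : ∀ C : Set M, IsCompact C → ∀ᶠ k in atTop, C ⊆ (φ k).source := fun C hC =>
    (hΩ C hC).mono fun k hk => hk.trans (hφ k).1
  -- the curvature bound is used with the ball of the same time `t`
  filter_upwards [RicciCompactness.eventually_mem_metricBall hsource (fun k => (hφ k).2.1) hconv ht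
    hx] with k hk
  rw [(hφ k).2.2.2] at hk
  exact (h_flow (σ k)).inner_le (fun s hs => hK t ht s hs (σ k) _ hk) ht h0 _
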